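/- Let $k$ be a natural number, let $d_1,\dots,d_k\ge 1$ be integers, and let $S^{d}$ be the set of unit vectors of $\mathbb{C}^d$. For $|\varphi\rangle\in S^d$ write $\varphi=|\varphi\rangle\langle\varphi|$ for the corresponding rank-one projector. For a positive semidefinite operator $\Pi$ on $\mathbb{C}^{d_1}\otimes\cdots\otimes\mathbb{C}^{d_k}$ put $$\nu(\Pi):=\max\{\operatorname{tr}\,\Pi(\varphi_1\otimes\cdots\otimes\varphi_k) : |\varphi_1\rangle\in S^{d_1},\dots,|\varphi_k\rangle\in S^{d_k}\},$$ and, for a positive integer $n$, $$\mu_k^n(\Pi):=\mathbb{E}_{\varphi_1,\dots,\varphi_k}\big(\operatorname{tr}\,\Pi(\varphi_1\otimes\cdots\otimes\varphi_k)\big)^n,$$ where $|\varphi_1\rangle,\dots,|\varphi_k\rangle$ are independent and each $|\varphi_i\rangle$ is distributed according to the unitarily invariant probability measure on $S^{d_i}$. Then for every positive semidefinite $\Pi$ and every integer $n>0$, $$\mu_k^n(\Pi)\ \ge\ \frac{\nu(\Pi)^n}{\prod_{i=1}^k\binom{d_i+n-1}{n}}.$$ -/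

import Mathlib

open MeasureTheory
open scoped ComplexOrder Pointwise

noncomputable section

namespace ProdMoment

/-- The set `S^d` of unit vectors (pure states) of `ℂ^d`. -/
abbrev UnitVec (d : ℕ) : Type :=
  Metric.sphere (0 : EuclideanSpace ℂ (Fin d)) 1

/-- The unitarily invariant probability measure on `S^d`: the normalized surface measure of the
unit sphere of `ℂ^d`. Its normalization and its unitary invariance are proved below. -/
def haarState (d : ℕ) : Measure (UnitVec d) :=
  ((volume : Measure (EuclideanSpace ℂ (Fin d))).toSphere Set.univ)⁻¹ •
    (volume : Measure (EuclideanSpace ℂ (Fin d))).toSphere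

/-- The rank-one projector `φ = |φ⟩⟨φ|` of a unit vector. -/
def proj {d : ℕ} (φ : UnitVec d) : Matrix (Fin d) (Fin d) ℂ :=
  Matrix.of fun a b => φ.1 a * star (φ.1 b)

/-- The tensor product `A_1 ⊗ ⋯ ⊗ A_k`, as a matrix in the product basis of
`ℂ^{d_1} ⊗ ⋯ ⊗ ℂ^{d_k}`, whose vectors are indexed by `(a_1, …, a_k)` with `a_i ∈ [d_i]`. -/
def tensor {k : ℕ} {d : Fin k → ℕ} (A : ∀ i, Matrix (Fin (d i)) (Fin (d i)) ℂ) :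
    Matrix (∀ i, Fin (d i)) (∀ i, Fin (d i)) ℂ :=
  Matrix.of fun a b => ∏ i, A i (a i) (b i)

/-- The overlap `tr Π (φ_1 ⊗ ⋯ ⊗ φ_k)`. For Hermitian `Π` this trace is real
(see `trace_eq_overlap`). -/
def overlap {k : ℕ} {d : Fin k → ℕ} (P : Matrix (∀ i, Fin (d i)) (∀ i, Fin (d i)) ℂ)
    (φ : ∀ i, UnitVec (d i)) : ℝ :=
  (Matrix.trace (P * tensor fun i => proj (φ i))).re

/-- `ν(Π)`, the maximum of `tr (φ_1 ⊗ ⋯ ⊗ φ_k) Π` over unit vectors `φ_i ∈ S^{d_i}`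
(the maximum is attained, see `isGreatest_nu`). -/
def nu {k : ℕ} {d : Fin k → ℕ} (P : Matrix (∀ i, Fin (d i)) (∀ i, Fin (d i)) ℂ) : ℝ :=
  sSup (Set.range (overlap P))

/-- The `n`-th moment `μ_k^n(Π) = E (tr Π (φ_1 ⊗ ⋯ ⊗ φ_k))^n` over independent uniformly random
unit vectors `φ_i ∈ S^{d_i}`. -/
def mu {k : ℕ} {d : Fin k → ℕ} (n : ℕ) (P : Matrix (∀ i, Fin (d i)) (∀ i, Fin (d i)) ℂ) : ℝ :=
  ∫ φ, overlap P φ ^ n ∂(Measure.pi fun i => haarState (d i))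

instance haarState_isFinite (d : ℕ) : IsFiniteMeasure (haarState d) := by
  constructor
  rw [haarState, Measure.smul_apply, smul_eq_mul]
  exact lt_of_le_of_lt (ENNReal.inv_mul_le_one _) ENNReal.one_lt_top

theorem haarState_isProbability {d : ℕ} (hd : 0 < d) : IsProbabilityMeasure (haarState d) := by
  have : Nonempty (Fin d) := ⟨⟨0, hd⟩⟩
  constructor
  rw [haarState, Measure.smul_apply, smul_eq_mul]
  refine ENNReal.inv_mul_cancel ?_ (measure_ne_top _ _)
  rw [Ne, Measure.measure_univ_eq_zero]
  exact Measure.toSphere_ne_zero _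

/-- The action of a unitary on unit vectors. -/
def rotate {d : ℕ} (U : EuclideanSpace ℂ (Fin d) ≃ₗᵢ[ℂ] EuclideanSpace ℂ (Fin d))
    (φ : UnitVec d) : UnitVec d :=
  ⟨U φ.1, by simp⟩

theorem map_rotate_haarState {d : ℕ}
    (U : EuclideanSpace ℂ (Fin d) ≃ₗᵢ[ℂ] EuclideanSpace ℂ (Fin d)) :
    (haarState d).map (rotate U) = haarState d := by
  have hc : Measurable (rotate U) := by
    refine Continuous.measurable ?_
    unfold rotate
    exact Continuous.subtype_mk (U.continuous.comp continuous_subtype_val) _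
  let V : EuclideanSpace ℂ (Fin d) ≃ₗᵢ[ℝ] EuclideanSpace ℂ (Fin d) :=
    ⟨U.toLinearEquiv.restrictScalars ℝ, U.norm_map⟩
  have hV : MeasurePreserving V := V.measurePreserving
  unfold haarState
  rw [Measure.map_smul]
  congr 1
  ext s hs
  rw [Measure.map_apply hc hs, Measure.toSphere_apply' _ (hc hs), Measure.toSphere_apply' _ hs]
  congr 1
  have e : Set.Ioo (0 : ℝ) 1 • (Subtype.val '' (rotate U ⁻¹' s)) =
      V ⁻¹' (Set.Ioo (0 : ℝ) 1 • (Subtype.val '' s)) := by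
    ext x
    simp only [Set.mem_smul, Set.mem_image, Set.mem_preimage]
    constructor
    · rintro ⟨r, hr, _, ⟨y, hy, rfl⟩, rfl⟩
      exact ⟨r, hr, _, ⟨_, hy, rfl⟩, (V.map_smul r y.1).symm⟩
    · rintro ⟨r, hr, _, ⟨y, hy, rfl⟩, h⟩
      refine ⟨r, hr, _, ⟨rotate U.symm y, ?_, rfl⟩, ?_⟩
      · have : rotate U (rotate U.symm y) = y := Subtype.ext (U.apply_symm_apply y.1)
        rw [this]; exact hy
      · apply V.injective
        rw [← h, V.map_smul]
        congr 1
        exact U.apply_symm_apply y.1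
  rw [e]
  exact (hV.measure_preimage_equiv (f := V.toHomeomorph.toMeasurableEquiv) _)

theorem trace_eq_overlap {k : ℕ} {d : Fin k → ℕ}
    {P : Matrix (∀ i, Fin (d i)) (∀ i, Fin (d i)) ℂ} (hP : P.IsHermitian)
    (φ : ∀ i, UnitVec (d i)) :
    Matrix.trace (P * tensor fun i => proj (φ i)) = (overlap P φ : ℂ) := by
  have hT : (tensor fun i => proj (φ i)).IsHermitian := by
    ext a b
    simp [tensor, proj, mul_comm]
  refine (Complex.conj_eq_iff_re.mp ?_).symm
  change star _ = _
  rw [← Matrix.trace_conjTranspose, Matrix.conjTranspose_mul, hP.eq, hT.eq, Matrix.trace_mul_comm]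

theorem continuous_overlap {k : ℕ} {d : Fin k → ℕ}
    (P : Matrix (∀ i, Fin (d i)) (∀ i, Fin (d i)) ℂ) : Continuous (overlap P) := by
  unfold overlap tensor proj
  simp only [Matrix.trace, Matrix.diag, Matrix.mul_apply, Matrix.of_apply]
  fun_prop

theorem isGreatest_nu {k : ℕ} {d : Fin k → ℕ} (hd : ∀ i, 0 < d i)
    (P : Matrix (∀ i, Fin (d i)) (∀ i, Fin (d i)) ℂ) :
    IsGreatest (Set.range (overlap P)) (nu P) := by
  have : ∀ i, Nonempty (UnitVec (d i)) := fun i => by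
    have : Nonempty (Fin (d i)) := ⟨⟨0, hd i⟩⟩
    exact (NormedSpace.sphere_nonempty.mpr zero_le_one).to_subtype
  exact (isCompact_range (continuous_overlap P)).isGreatest_sSup (Set.range_nonempty _)

theorem integrable_overlap_pow {k : ℕ} {d : Fin k → ℕ} (n : ℕ)
    (P : Matrix (∀ i, Fin (d i)) (∀ i, Fin (d i)) ℂ) :
    Integrable (fun φ => overlap P φ ^ n) (Measure.pi fun i => haarState (d i)) := by
  have h := (continuous_overlap P).pow n
  exact h.integrable_of_hasCompactSupport (HasCompactSupport.of_compactSpace _)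

end ProdMoment

end

namespace ProdMoment

open scoped InnerProductSpace
open Module (finrank)

/-! Writing Π = B†B makes the overlap equal to ‖M(φ₁,…,φ_k)‖² with M multilinear, so in each
variable separately it is ‖Lφ‖² for a linear L. For such L, ‖Lu‖^(2n) ≤ C(d+n-1,n) · E‖Lφ‖^(2n)
(`norm_apply_pow_le_integral`): a well-chosen functional ⟨v,·⟩ is dominated by ‖L·‖, and its moment
is known exactly by unitary invariance (`integral_haarState_inner`). Applying this one variable at a
time, starting from a maximizer of the overlap, multiplies the binomials
(`le_prod_mul_lintegral_pi`). -/

/-! ### Moments of one coordinate on the complex sphere -/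

/-- Integration in polar coordinates of the product of a homogeneous function of degree `m` and a
radial function. -/
theorem integral_homogeneous_mul_radial {E : Type*} [NormedAddCommGroup E] [NormedSpace ℝ E]
    [FiniteDimensional ℝ E] [Nontrivial E] [MeasurableSpace E] [BorelSpace E] (μ : Measure E)
    [μ.IsAddHaarMeasure] (m : ℕ) (f : E → ℝ)
    (hf : ∀ (r : ℝ) (x : E), 0 < r → f (r • x) = r ^ m * f x)
    (g : ℝ → ℝ) :
    ∫ x, f x * g ‖x‖ ∂μ =
      (∫ x : Metric.sphere (0 : E) 1, f x ∂μ.toSphere) *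
        ∫ r in Set.Ioi (0 : ℝ), r ^ (finrank ℝ E - 1 + m) * g r := by
  calc
    ∫ x, f x * g ‖x‖ ∂μ = ∫ x : ({(0)}ᶜ : Set E), f x.1 * g ‖x.1‖ ∂(μ.comap (↑)) := by
      rw [integral_subtype_comap (measurableSet_singleton _).compl fun x ↦ f x * g ‖x‖,
        restrict_compl_singleton]
    _ = ∫ x : Metric.sphere (0 : E) 1 × Set.Ioi (0 : ℝ), f x.1 * (x.2.1 ^ m * g x.2)
          ∂μ.toSphere.prod (.volumeIoiPow (finrank ℝ E - 1)) := by
      rw [← μ.measurePreserving_homeomorphUnitSphereProd.integral_comp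
        (Homeomorph.measurableEmbedding _)]
      refine integral_congr_ae (.of_forall fun x => ?_)
      have hx : 0 < ‖x.1‖ := norm_pos_iff.mpr x.2
      have h := hf ‖x.1‖ (‖x.1‖⁻¹ • x.1) hx
      rw [smul_smul, mul_inv_cancel₀ hx.ne', one_smul] at h
      simp only [homeomorphUnitSphereProd_apply_fst_coe, homeomorphUnitSphereProd_apply_snd_coe]
      rw [h]
      ring
    _ = (∫ x : Metric.sphere (0 : E) 1, f x ∂μ.toSphere) *
          ∫ r : Set.Ioi (0 : ℝ), r.1 ^ m * g r ∂.volumeIoiPow (finrank ℝ E - 1) :=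
      integral_prod_mul (fun x : Metric.sphere (0 : E) 1 => f x)
        (fun r : Set.Ioi (0 : ℝ) => r.1 ^ m * g r)
    _ = _ := by
      congr 1
      simp only [Measure.volumeIoiPow, ENNReal.ofReal]
      rw [integral_withDensity_eq_integral_smul,
        integral_subtype_comap measurableSet_Ioi fun a ↦
          Real.toNNReal (a ^ (finrank ℝ E - 1)) • (a ^ m * g a),
        setIntegral_congr_fun measurableSet_Ioi fun x hx ↦ ?_]
      · rw [NNReal.smul_def, Real.coe_toNNReal _ (pow_nonneg hx.out.le _), smul_eq_mul, pow_add,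
          mul_assoc]
      · exact (measurable_subtype_coe.pow_const _).real_toNNReal

theorem integral_Ioi_pow_mul_exp_neg_sq (m : ℕ) :
    ∫ r in Set.Ioi (0 : ℝ), r ^ (2 * m + 1) * Real.exp (-r ^ 2) = (m.factorial : ℝ) / 2 := by
  have h := integral_rpow_mul_exp_neg_rpow (p := 2) (q := (2 * m + 1 : ℕ)) two_pos
    (by push_cast; linarith [Nat.cast_nonneg (α := ℝ) m])
  simp only [Real.rpow_natCast, Real.rpow_two] at h
  rw [h, ← Real.Gamma_nat_eq_factorial]
  push_cast
  rw [show ((2 * m + 1 + 1 : ℝ) / 2) = m + 1 by ring]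
  ring

theorem integral_complex_norm_pow_mul_exp_neg_sq (n : ℕ) :
    ∫ z : ℂ, ‖z‖ ^ (2 * n) * Real.exp (-‖z‖ ^ 2) = Real.pi * n.factorial := by
  have h := Complex.integral_rpow_mul_exp_neg_rpow (p := 2) (q := (2 * n : ℕ)) one_le_two
    (by push_cast; linarith [Nat.cast_nonneg (α := ℝ) n])
  simp only [Real.rpow_natCast, Real.rpow_two] at h
  rw [h, ← Real.Gamma_nat_eq_factorial]
  push_cast
  rw [show ((2 * n + 2 : ℝ) / 2) = n + 1 by ring]
  ring

theorem integral_pi_coord_gaussian {d : ℕ} (i : Fin d) (n : ℕ) :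
    ∫ x : Fin d → ℂ, ‖x i‖ ^ (2 * n) * Real.exp (-∑ j, ‖x j‖ ^ 2) = Real.pi ^ d * n.factorial := by
  have h (x : Fin d → ℂ) : ‖x i‖ ^ (2 * n) * Real.exp (-∑ j, ‖x j‖ ^ 2) =
      ∏ j, (‖x j‖ ^ (2 * if j = i then n else 0) * Real.exp (-‖x j‖ ^ 2)) := by
    rw [Finset.prod_mul_distrib, ← Real.exp_sum, Finset.sum_neg_distrib]
    congr 1
    rw [Finset.prod_eq_single i (by intro j _ hj; simp [hj]) (by simp)]
    simp
  simp_rw [h]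
  rw [integral_fintype_prod_volume_eq_prod
    (fun j (z : ℂ) => ‖z‖ ^ (2 * if j = i then n else 0) * Real.exp (-‖z‖ ^ 2))]
  simp_rw [integral_complex_norm_pow_mul_exp_neg_sq]
  rw [Finset.prod_mul_distrib, Finset.prod_eq_single (a := i)
    (f := fun j => (((if j = i then n else 0).factorial : ℕ) : ℝ))
    (by intro j _ hj; simp [hj]) (by simp)]
  simp

/-- Uniqueness of Haar measure. The value of `c` is irrelevant, since normalization later fixes the
overall constant. -/
theorem exists_integral_euclidean_eq_smul_integral_pi (d : ℕ) :
    ∃ c : ℝ, ∀ f : (Fin d → ℂ) → ℝ,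
      ∫ x : EuclideanSpace ℂ (Fin d), f (fun j => x j) = c * ∫ x : Fin d → ℂ, f x := by
  let e : EuclideanSpace ℂ (Fin d) ≃L[ℝ] (Fin d → ℂ) :=
    PiLp.continuousLinearEquiv 2 ℝ (fun _ : Fin d => ℂ)
  have hH : (Measure.map e volume).IsAddHaarMeasure := e.isAddHaarMeasure_map volume
  refine ⟨(Measure.addHaarScalarFactor (Measure.map e volume) volume : NNReal), fun f => ?_⟩
  have h := integral_map_equiv (μ := (volume : Measure (EuclideanSpace ℂ (Fin d))))
    e.toHomeomorph.toMeasurableEquiv f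
  have h2 := Measure.isAddLeftInvariant_eq_smul (Measure.map e volume)
    (volume : Measure (Fin d → ℂ))
  have h3 : ∫ y, f y ∂(Measure.map e volume) = ∫ x : EuclideanSpace ℂ (Fin d), f (fun j => x j) := h
  rw [← h3]
  refine (congrArg (fun ν => ∫ y, f y ∂ν) h2).trans ?_
  exact integral_smul_nnreal_measure _ _

/-- The Gaussian integral of |x_i|^(2n) is evaluated both in polar form and as a product over
coordinates. What matters is that `c` does not depend on `n`. -/
theorem integral_toSphere_coord {d : ℕ} (i : Fin d) :
    ∃ c : ℝ, ∀ n : ℕ,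
      ∫ φ : UnitVec d, ‖φ.1 i‖ ^ (2 * n)
        ∂(volume : Measure (EuclideanSpace ℂ (Fin d))).toSphere = c * (n.factorial / (d - 1 + n).factorial : ℝ) := by
  have : Nonempty (Fin d) := ⟨i⟩
  have hd : 0 < d := i.pos
  obtain ⟨c, hc⟩ := exists_integral_euclidean_eq_smul_integral_pi d
  refine ⟨2 * c * Real.pi ^ d, fun n => ?_⟩
  have h := integral_homogeneous_mul_radial (volume : Measure (EuclideanSpace ℂ (Fin d))) (2 * n)
    (fun x => ‖x i‖ ^ (2 * n))
    (fun r x hr => by simp [mul_pow, abs_of_pos hr]) (fun r => Real.exp (-r ^ 2))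
  have hdim : finrank ℝ (EuclideanSpace ℂ (Fin d)) - 1 + 2 * n = 2 * (d - 1 + n) + 1 := by
    rw [← Module.finrank_mul_finrank ℝ ℂ, Complex.finrank_real_complex, finrank_euclideanSpace_fin]
    omega
  rw [hdim, integral_Ioi_pow_mul_exp_neg_sq] at h
  simp_rw [EuclideanSpace.norm_sq_eq] at h
  rw [hc (fun x => ‖x i‖ ^ (2 * n) * Real.exp (-∑ j, ‖x j‖ ^ 2)),
    integral_pi_coord_gaussian] at h
  have hp : ((d - 1 + n).factorial : ℝ) ≠ 0 := by positivity
  field_simp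
  linarith

theorem integral_haarState_coord {d : ℕ} (i : Fin d) (n : ℕ) :
    ∫ φ, ‖φ.1 i‖ ^ (2 * n) ∂haarState d = (Nat.choose (d + n - 1) n : ℝ)⁻¹ := by
  have hd : 0 < d := i.pos
  have := haarState_isProbability hd
  obtain ⟨c, hc⟩ := integral_toSphere_coord i
  have key : ∃ c : ℝ, ∀ n : ℕ, ∫ φ : UnitVec d, ‖φ.1 i‖ ^ (2 * n) ∂haarState d =
      c * (n.factorial / (d - 1 + n).factorial : ℝ) := by
    refine ⟨((volume : Measure (EuclideanSpace ℂ (Fin d))).toSphere Set.univ)⁻¹.toReal * c,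
      fun n => ?_⟩
    rw [haarState, integral_smul_measure, hc, smul_eq_mul, mul_assoc]
  obtain ⟨c, hc⟩ := key
  -- The zeroth moment of a probability measure is 1, which forces c = (d-1)!.
  have h0 := hc 0
  simp only [mul_zero, pow_zero, integral_const, probReal_univ, smul_eq_mul, mul_one, add_zero,
    Nat.factorial_zero, Nat.cast_one] at h0
  have hp : ((d - 1).factorial : ℝ) ≠ 0 := by positivity
  have hcv : c = (d - 1).factorial := by field_simp at h0; linarith
  rw [hc, hcv, show d + n - 1 = n + (d - 1) by omega, Nat.cast_add_choose, add_comm n]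
  field_simp

/-! ### The inequality in one variable -/

theorem integral_haarState_inner {d : ℕ} (hd : 0 < d) {n : ℕ} (hn : 0 < n)
    (v : EuclideanSpace ℂ (Fin d)) :
    ∫ φ : UnitVec d, ‖⟪v, φ.1⟫_ℂ‖ ^ (2 * n) ∂haarState d =
      ‖v‖ ^ (2 * n) / Nat.choose (d + n - 1) n := by
  rcases eq_or_ne v 0 with rfl | hv
  · simp [hn.ne']
  have hv' : ‖v‖ ≠ 0 := norm_ne_zero_iff.mpr hv
  let i : Fin d := ⟨0, hd⟩
  -- Completing v/‖v‖ to an orthonormal basis gives a unitary `b.repr` that turns ⟨v,·⟩ into ‖v‖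
  -- times a coordinate.
  have horth : Orthonormal ℂ
      (({i} : Set (Fin d)).domRestrict fun _ => ((‖v‖⁻¹ : ℝ) : ℂ) • v) := by
    refine ⟨fun _ => ?_, fun a b hab => (hab (Subsingleton.elim a b)).elim⟩
    simp [Set.domRestrict, norm_smul, hv']
  obtain ⟨b, hb⟩ := horth.exists_orthonormalBasis_extension_of_card_eq (by simp)
  have hbi : b i = ((‖v‖⁻¹ : ℝ) : ℂ) • v := hb i rfl
  have hvb : v = ((‖v‖ : ℝ) : ℂ) • b i := by
    rw [hbi, smul_smul, ← Complex.ofReal_mul, mul_inv_cancel₀ hv']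
    simp
  have hin (φ : UnitVec d) : ‖⟪v, φ.1⟫_ℂ‖ ^ (2 * n) =
      ‖v‖ ^ (2 * n) * ‖(rotate b.repr φ).1 i‖ ^ (2 * n) := by
    conv_lhs => rw [hvb]
    rw [inner_smul_left, norm_mul, mul_pow, rotate, b.repr_apply_apply]
    simp
  have hc : Continuous (rotate b.repr) :=
    Continuous.subtype_mk (b.repr.continuous.comp continuous_subtype_val) _
  simp_rw [hin]
  rw [integral_const_mul, ← integral_map (μ := haarState d) (φ := rotate b.repr)
      (f := fun φ : UnitVec d => ‖φ.1 i‖ ^ (2 * n)) hc.aemeasurable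
      (by
        refine Continuous.aestronglyMeasurable ?_
        fun_prop),
    map_rotate_haarState, integral_haarState_coord, div_eq_mul_inv]

theorem norm_apply_pow_le_integral {d : ℕ} (hd : 0 < d) {n : ℕ} (hn : 0 < n)
    {F : Type*} [NormedAddCommGroup F] [InnerProductSpace ℂ F] [FiniteDimensional ℂ F]
    (L : EuclideanSpace ℂ (Fin d) →ₗ[ℂ] F) (u : UnitVec d) :
    ‖L u.1‖ ^ (2 * n) ≤
      Nat.choose (d + n - 1) n * ∫ φ : UnitVec d, ‖L φ.1‖ ^ (2 * n) ∂haarState d := by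
  have hC : (0 : ℝ) < Nat.choose (d + n - 1) n := by
    exact_mod_cast Nat.choose_pos (by omega)
  rcases eq_or_ne (L u.1) 0 with h0 | h0
  · rw [h0, norm_zero, zero_pow (by omega)]
    exact mul_nonneg hC.le (integral_nonneg fun _ => by positivity)
  have h0' : ‖L u.1‖ ≠ 0 := norm_ne_zero_iff.mpr h0
  -- Projecting onto the direction of Lu loses nothing at u, while |⟨v,φ⟩| = |⟨w,Lφ⟩| ≤ ‖Lφ‖
  -- everywhere.
  let w : F := ((‖L u.1‖⁻¹ : ℝ) : ℂ) • L u.1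
  have hw : ‖w‖ = 1 := by simp [w, norm_smul, h0']
  let v := L.adjoint w
  have hu : ‖u.1‖ = 1 := by simp
  have hv : ‖L u.1‖ ≤ ‖v‖ := by
    have h : ‖⟪v, u.1⟫_ℂ‖ = ‖L u.1‖ := by
      simp only [v, w, LinearMap.adjoint_inner_left, inner_smul_left, inner_self_eq_norm_sq_to_K]
      simp [sq, h0']
    calc ‖L u.1‖ = ‖⟪v, u.1⟫_ℂ‖ := h.symm
      _ ≤ ‖v‖ * ‖u.1‖ := norm_inner_le_norm _ _
      _ = ‖v‖ := by rw [hu, mul_one]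
  have hL : Continuous L := L.continuous_of_finiteDimensional
  rw [← div_le_iff₀' hC]
  calc ‖L u.1‖ ^ (2 * n) / Nat.choose (d + n - 1) n
      ≤ ‖v‖ ^ (2 * n) / Nat.choose (d + n - 1) n := by gcongr
    _ = ∫ φ : UnitVec d, ‖⟪v, φ.1⟫_ℂ‖ ^ (2 * n) ∂haarState d :=
      (integral_haarState_inner hd hn v).symm
    _ ≤ _ := by
      refine integral_mono ?_ ?_ fun φ => ?_
      · refine Continuous.integrable_of_hasCompactSupport (by fun_prop)
          (HasCompactSupport.of_compactSpace _)
      · refine Continuous.integrable_of_hasCompactSupport (by fun_prop)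
          (HasCompactSupport.of_compactSpace _)
      · refine pow_le_pow_left₀ (norm_nonneg _) ?_ _
        rw [LinearMap.adjoint_inner_left]
        simpa [hw] using norm_inner_le_norm (𝕜 := ℂ) w (L φ.1)

/-! ### From one variable to many -/

/-- Bounds in each variable separately multiply up to a bound in all variables. -/
theorem le_prod_mul_lintegral_pi {ι : Type*} [Fintype ι] [DecidableEq ι] {X : ι → Type*}
    [∀ i, MeasurableSpace (X i)] (μ : ∀ i, Measure (X i)) [∀ i, SigmaFinite (μ i)]
    (f : (∀ i, X i) → ENNReal) (hf : Measurable f) (C : ι → ENNReal)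
    (h : ∀ i x, f x ≤ C i * ∫⁻ t, f (Function.update x i t) ∂μ i) (x : ∀ i, X i) :
    f x ≤ (∏ i, C i) * ∫⁻ y, f y ∂Measure.pi μ := by
  have key (s : Finset ι) (x : ∀ i, X i) : f x ≤ (∏ i ∈ s, C i) * lmarginal μ s f x := by
    induction s using Finset.induction_on generalizing x with
    | empty => simp
    | insert i s hi ih =>
      rw [lmarginal_insert f hf hi, Finset.prod_insert hi, mul_assoc]
      refine (h i x).trans (mul_le_mul_right ?_ _)
      rw [← lintegral_const_mul]
      · exact lintegral_mono fun t => ih _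
      · exact (hf.lmarginal μ).comp (measurable_update x)
  simpa using key Finset.univ x

open scoped MatrixOrder Matrix.Norms.L2Operator in
theorem exists_eq_conjTranspose_mul_self {ι : Type*} [Fintype ι] [DecidableEq ι]
    {P : Matrix ι ι ℂ} (hP : P.PosSemidef) : ∃ B : Matrix ι ι ℂ, P = B.conjTranspose * B :=
  CStarAlgebra.nonneg_iff_eq_star_mul_self.mp hP.nonneg

theorem exists_overlap_eq_norm_sq {k : ℕ} {d : Fin k → ℕ}
    {P : Matrix (∀ i, Fin (d i)) (∀ i, Fin (d i)) ℂ} (hP : P.PosSemidef) :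
    ∃ M : MultilinearMap ℂ (fun i => EuclideanSpace ℂ (Fin (d i)))
        (EuclideanSpace ℂ (∀ i, Fin (d i))),
      ∀ φ : ∀ i, UnitVec (d i), overlap P φ = ‖M fun i => (φ i).1‖ ^ 2 := by
  obtain ⟨B, rfl⟩ := exists_eq_conjTranspose_mul_self hP
  let T : MultilinearMap ℂ (fun i => EuclideanSpace ℂ (Fin (d i))) ((∀ i, Fin (d i)) → ℂ) :=
    MultilinearMap.pi fun a => (MultilinearMap.mkPiAlgebra ℂ (Fin k) ℂ).compLinearMap
      fun i => (EuclideanSpace.proj (a i)).toLinearMap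
  refine ⟨((WithLp.linearEquiv 2 ℂ _).symm.toLinearMap ∘ₗ B.mulVecLin).compMultilinearMap T,
    fun φ => ?_⟩
  let t : (∀ i, Fin (d i)) → ℂ := fun a => ∏ i, (φ i).1 (a i)
  have hT : T (fun i => (φ i).1) = t := by
    ext a
    simp [T, t]
  -- The tensor of projectors is |t⟩⟨t|, so the trace against B†B becomes ‖Bt‖².
  have hten : (tensor fun i => proj (φ i)) = Matrix.vecMulVec t (star t) := by
    ext a b
    simp [tensor, proj, Matrix.vecMulVec, t, Finset.prod_mul_distrib]
  rw [LinearMap.compMultilinearMap_apply, hT, overlap, hten, Matrix.mul_vecMulVec,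
    Matrix.trace_vecMulVec, dotProduct_comm, ← Matrix.mulVec_mulVec, Matrix.dotProduct_mulVec,
    Matrix.vecMul_conjTranspose, star_star, EuclideanSpace.norm_sq_eq]
  simp [dotProduct, Complex.sq_norm, Complex.normSq_apply]

end ProdMoment

theorem mainTheorem12 (k : ℕ) (d : Fin k → ℕ) (hd : ∀ i, 0 < d i)
    (P : Matrix (∀ i, Fin (d i)) (∀ i, Fin (d i)) ℂ) (hP : P.PosSemidef)
    (n : ℕ) (hn : 0 < n) :
    ProdMoment.mu n P ≥
      ProdMoment.nu P ^ n / ∏ i, (Nat.choose (d i + n - 1) n : ℝ) := by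
  obtain ⟨M, hM⟩ := ProdMoment.exists_overlap_eq_norm_sq hP
  obtain ⟨⟨φ₀, hφ₀⟩, -⟩ := ProdMoment.isGreatest_nu hd P
  have hnn (φ : ∀ i, ProdMoment.UnitVec (d i)) : 0 ≤ ProdMoment.overlap P φ := by
    rw [hM]; positivity
  have hCpos : 0 < ∏ i, (Nat.choose (d i + n - 1) n : ℝ) :=
    Finset.prod_pos fun i _ => by
      exact_mod_cast Nat.choose_pos (by have := hd i; omega)
  have hcont := (ProdMoment.continuous_overlap P).pow n
  rw [ge_iff_le, div_le_iff₀ hCpos, mul_comm, ← hφ₀]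
  have h := ProdMoment.le_prod_mul_lintegral_pi (fun i => ProdMoment.haarState (d i))
    (fun φ => ENNReal.ofReal (ProdMoment.overlap P φ ^ n)) hcont.measurable.ennreal_ofReal
    (fun i => ENNReal.ofReal (Nat.choose (d i + n - 1) n)) (fun i φ => ?_) φ₀
  · rw [← ENNReal.ofReal_prod_of_nonneg (fun _ _ => Nat.cast_nonneg _),
      ← ofReal_integral_eq_lintegral_ofReal (ProdMoment.integrable_overlap_pow n P)
        (.of_forall fun φ => pow_nonneg (hnn φ) n), ← ENNReal.ofReal_mul hCpos.le] at h
    exact (ENNReal.ofReal_le_ofReal_iff (mul_nonneg hCpos.le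
      (integral_nonneg fun φ => pow_nonneg (hnn φ) n))).mp h
  · have hc : Continuous fun t => ProdMoment.overlap P (Function.update φ i t) ^ n :=
      hcont.comp (continuous_const.update i continuous_id)
    rw [← ofReal_integral_eq_lintegral_ofReal
        (hc.integrable_of_hasCompactSupport (HasCompactSupport.of_compactSpace _))
        (.of_forall fun t => pow_nonneg (hnn _) n), ← ENNReal.ofReal_mul (Nat.cast_nonneg _)]
    refine ENNReal.ofReal_le_ofReal ?_
    have hL (t : ProdMoment.UnitVec (d i)) : ProdMoment.overlap P (Function.update φ i t) ^ n =
        ‖M.toLinearMap (fun j => (φ j).1) i t.1‖ ^ (2 * n) := by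
      rw [hM, pow_mul, MultilinearMap.toLinearMap_apply]
      congr 4
      ext j : 1
      rcases eq_or_ne j i with rfl | hj
      · simp
      · simp [hj]
    have h1 := ProdMoment.norm_apply_pow_le_integral (hd i) hn
      (M.toLinearMap (fun j => (φ j).1) i) (φ i)
    -- The left side becomes the overlap at `Function.update φ i (φ i)`, which is φ itself.
    simp_rw [← hL] at h1
    simpa using h1
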